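/- Let $K$ be a field, let $1 \le t \le n$ be integers, and let $S = K[x_1,\ldots,x_n]$. Let $L_n$ be the line graph (path graph) with vertex set $\{x_1,\ldots,x_n\}$ and edge set $\{\{x_j,x_{j+1}\} : 1 \le j \le n-1\}$. Let $I_t(L_n) \subseteq S$ be its $t$-path ideal, that is, the ideal generated by all monomials $x_{i_1}x_{i_2}\cdots x_{i_t}$ such that $x_{i_1},\ldots,x_{i_t}$ are pairwise distinct and $\{x_{i_k},x_{i_{k+1}}\}$ is an edge of $L_n$ for $1 \le k \le t-1$ (for $t=1$ this is the ideal $(x_1,\ldots,x_n)$). Then $I_t(L_n)$ is normal, that is, $$\overline{I_t(L_n)^s} = I_t(L_n)^s \qquad \text{for all } s \ge 1,$$ where, for an ideal $J$ of $S$, the integral closure $\overline{J}$ is the set of all $r \in S$ satisfying an equation $r^m + a_1 r^{m-1} + \cdots + a_m = 0$ with $m \ge 1$ and $a_i \in J^i$ for $i = 1,\ldots,m$. -/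

import Mathlib

/-- The `t`-path ideal of a simple graph `G` in the polynomial ring `K[x_v : v ∈ V]`: the ideal
generated by the monomials `x_{i_1} ⋯ x_{i_t}`, where `i_1, …, i_t` are the successive, pairwise
distinct vertices of a path of `G` with exactly `t` vertices (for `t = 1`, a single vertex). -/
noncomputable def pathIdeal (K : Type*) [CommRing K] {V : Type*} (G : SimpleGraph V) (t : ℕ) :
    Ideal (MvPolynomial V K) :=
  Ideal.span {m | ∃ (u v : V) (p : G.Walk u v), p.IsPath ∧ p.support.length = t ∧
    m = (p.support.map (fun w => (MvPolynomial.X w : MvPolynomial V K))).prod}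

/-- The integral closure of an ideal `I` in the ring `R`: the set of all `r` that satisfy an
equation `r ^ m + a 1 * r ^ (m - 1) + ⋯ + a m = 0` with `m ≥ 1` and `a i ∈ I ^ i` for
`i = 1, …, m`. -/
def idealIntegralClosure {R : Type*} [CommRing R] (I : Ideal R) : Set R :=
  {r | ∃ m : ℕ, 1 ≤ m ∧ ∃ a : ℕ → R, (∀ i ∈ Finset.Icc 1 m, a i ∈ I ^ i) ∧
    r ^ m + ∑ i ∈ Finset.Icc 1 m, a i * r ^ (m - i) = 0}

/-- An ideal is normal if all of its positive powers are integrally closed. -/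
def IsNormalIdeal {R : Type*} [CommRing R] (I : Ideal R) : Prop :=
  ∀ s : ℕ, 1 ≤ s → idealIntegralClosure (I ^ s) = ((I ^ s : Ideal R) : Set R)

/-!
A path of a subgraph of a Hasse diagram of a finite linear order visits an interval of vertices, so
the path ideal `I` is generated by squarefree monomials supported on intervals. Write `P_C` for the
ideal generated by the variables in `C`. Intervals have the packing property: if the exponent
vector of a monomial has weight at least `s` on each set `C` that meets all the intervals, then `s`
of the generators, with repetition, have a product that divides the monomial. Hence `I ^ s` is the
intersection of the ideals `P_C ^ s` over these sets `C`. Each `P_C ^ s` is integrally closed,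
because it consists of the polynomials that become divisible by `T ^ s` when `T * x_i` is
substituted for `x_i`, `i ∈ C`.
-/

open scoped nonZeroDivisors

section IntegralClosure

variable {R A : Type*} [CommRing R] [CommRing A]

/-- An ideal that is equal to its integral closure. -/
def IsIntegrallyClosedIdeal (I : Ideal R) : Prop :=
  idealIntegralClosure I = (I : Set R)

theorem subset_idealIntegralClosure (I : Ideal R) : (I : Set R) ⊆ idealIntegralClosure I :=
  fun r hr => ⟨1, le_rfl, fun _ => -r, by simpa using hr, by simp⟩

theorem isIntegrallyClosedIdeal_iff_subset {I : Ideal R} :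
    IsIntegrallyClosedIdeal I ↔ idealIntegralClosure I ⊆ I :=
  ⟨fun h => h.subset, fun h => h.antisymm (subset_idealIntegralClosure I)⟩

theorem map_mem_idealIntegralClosure (f : R →+* A) {I : Ideal R} {J : Ideal A}
    (hIJ : I ≤ J.comap f) {r : R} (hr : r ∈ idealIntegralClosure I) :
    f r ∈ idealIntegralClosure J := by
  obtain ⟨m, hm, a, ha, heq⟩ := hr
  refine ⟨m, hm, fun i => f (a i), fun i hi => ?_, by simpa using congrArg f heq⟩
  exact Ideal.le_comap_pow f i (Ideal.pow_right_mono hIJ i (ha i hi))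

theorem idealIntegralClosure_mono {I J : Ideal R} (hIJ : I ≤ J) :
    idealIntegralClosure I ⊆ idealIntegralClosure J :=
  fun _ => map_mem_idealIntegralClosure (RingHom.id R) hIJ

theorem IsIntegrallyClosedIdeal.comap (f : R →+* A) {J : Ideal A}
    (hJ : IsIntegrallyClosedIdeal J) : IsIntegrallyClosedIdeal (J.comap f) :=
  isIntegrallyClosedIdeal_iff_subset.2 fun _ hr =>
    hJ.subset (map_mem_idealIntegralClosure f le_rfl hr)

theorem IsIntegrallyClosedIdeal.iInf {ι : Sort*} {J : ι → Ideal R}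
    (hJ : ∀ i, IsIntegrallyClosedIdeal (J i)) : IsIntegrallyClosedIdeal (⨅ i, J i) :=
  isIntegrallyClosedIdeal_iff_subset.2 fun _ hr => Ideal.mem_iInf.2 fun i =>
    (hJ i).subset (idealIntegralClosure_mono (iInf_le J i) hr)

theorem idealIntegralClosure_subset_radical (I : Ideal R) :
    idealIntegralClosure I ⊆ (I.radical : Set R) := by
  rintro r ⟨m, -, a, ha, heq⟩
  refine ⟨m, ?_⟩
  rw [eq_neg_of_add_eq_zero_left heq]
  refine neg_mem (sum_mem fun i hi => Ideal.mul_mem_right _ _ ?_)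
  exact Ideal.pow_le_self (Nat.one_le_iff_ne_zero.1 (Finset.mem_Icc.1 hi).1) (ha i hi)

theorem mem_idealIntegralClosure_of_mul_mem {x u : R} (hx : x ∈ R⁰) {J : Ideal R}
    (h : x * u ∈ idealIntegralClosure (Ideal.span {x} * J)) : u ∈ idealIntegralClosure J := by
  obtain ⟨m, hm, a, ha, heq⟩ := h
  have hdiv : ∀ i ∈ Finset.Icc 1 m, ∃ b ∈ J ^ i, x ^ i * b = a i := fun i hi => by
    simpa only [mul_pow, Ideal.span_singleton_pow, Ideal.mem_span_singleton_mul] using ha i hi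
  choose! b hb hab using hdiv
  refine ⟨m, hm, b, hb, mul_left_mem_nonZeroDivisors_eq_zero_iff (pow_mem hx m) |>.1 ?_⟩
  rw [← heq, mul_add, Finset.mul_sum, mul_pow]
  congr 1
  refine Finset.sum_congr rfl fun i hi => ?_
  calc x ^ m * (b i * u ^ (m - i))
      = x ^ (i + (m - i)) * (b i * u ^ (m - i)) := by
        rw [Nat.add_sub_cancel' (Finset.mem_Icc.1 hi).2]
    _ = x ^ i * b i * (x * u) ^ (m - i) := by ring
    _ = a i * (x * u) ^ (m - i) := by rw [hab i hi]

theorem isIntegrallyClosedIdeal_span_singleton_pow {x : R} (hx : x ∈ R⁰) (hrad : IsRadical x)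
    (s : ℕ) : IsIntegrallyClosedIdeal (Ideal.span {x} ^ s) := by
  rw [isIntegrallyClosedIdeal_iff_subset]
  induction s with
  | zero => simp
  | succ s ih =>
    intro r hr
    have hrx : r ∈ Ideal.span {x} :=
      (isRadical_iff_span_singleton.1 hrad) (idealIntegralClosure_subset_radical _
        (idealIntegralClosure_mono (Ideal.pow_le_self s.succ_ne_zero) hr))
    obtain ⟨u, rfl⟩ := Ideal.mem_span_singleton.1 hrx
    rw [pow_succ'] at hr ⊢
    exact Ideal.mul_mem_mul (Ideal.mem_span_singleton_self x)
      (ih (mem_idealIntegralClosure_of_mul_mem hx hr))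

end IntegralClosure

theorem isRadical_polynomial_X {R : Type*} [CommRing R] [IsReduced R] :
    IsRadical (Polynomial.X : Polynomial R) := fun m f hf => by
  rw [Polynomial.X_dvd_iff, Polynomial.coeff_zero_eq_eval_zero] at hf ⊢
  rw [Polynomial.eval_pow] at hf
  exact eq_zero_of_pow_eq_zero hf

section VariableIdeals

open MvPolynomial

variable {K σ : Type*} [CommRing K]

open scoped Classical in
/-- The substitution `x_i ↦ x_i * T` for `i ∈ C`, `x_i ↦ x_i` for `i ∉ C`, where `T` is a new
variable: the power of `T` records the degree in the variables of `C`. -/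
noncomputable def scaleVars (K : Type*) [CommRing K] (C : Finset σ) :
    MvPolynomial σ K →ₐ[K] Polynomial (MvPolynomial σ K) :=
  aeval fun i => Polynomial.C (X i) * Polynomial.X ^ (if i ∈ C then 1 else 0)

theorem scaleVars_monomial (C : Finset σ) (d : σ →₀ ℕ) (c : K) :
    scaleVars K C (monomial d c) = Polynomial.monomial (∑ i ∈ C, d i) (monomial d c) := by
  classical
  have hdeg : (d.prod fun i e => (Polynomial.X : Polynomial (MvPolynomial σ K)) ^
      ((if i ∈ C then 1 else 0) * e)) = Polynomial.X ^ ∑ i ∈ C, d i := by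
    rw [d.prod_of_support_subset (Finset.subset_union_left (s₂ := C)) _ (by simp),
      Finset.prod_pow_eq_pow_sum]
    simp [Finset.union_inter_cancel_right]
  rw [scaleVars, aeval_monomial]
  simp only [mul_pow, ← pow_mul, Finsupp.prod_mul]
  rw [hdeg, ← Polynomial.C_mul_X_pow_eq_monomial, monomial_eq, ← mul_assoc]
  simp only [map_mul, Finsupp.prod, map_prod, map_pow]
  rfl

theorem coeff_coeff_scaleVars (C : Finset σ) (f : MvPolynomial σ K) (d : σ →₀ ℕ) :
    ((scaleVars K C f).coeff (∑ i ∈ C, d i)).coeff d = f.coeff d := by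
  classical
  induction f using MvPolynomial.induction_on' with
  | monomial e c =>
    rw [scaleVars_monomial, Polynomial.coeff_monomial]
    by_cases h : e = d
    · simp [h]
    · simp [apply_ite (coeff d), coeff_monomial, h]
  | add p q hp hq => simp [hp, hq]

theorem span_X_image_pow_le_comap_scaleVars (C : Finset σ) (s : ℕ) :
    Ideal.span (X '' (C : Set σ)) ^ s ≤
      (Ideal.span {Polynomial.X} ^ s).comap (scaleVars K C).toRingHom := by
  refine (Ideal.pow_right_mono (Ideal.span_le.2 ?_) s).trans (Ideal.le_comap_pow _ s)
  rintro _ ⟨i, hi, rfl⟩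
  refine Ideal.mem_span_singleton.2 ?_
  simp [scaleVars, Finset.mem_coe.1 hi]

theorem monomial_mem_span_X_image_pow {C : Finset σ} {s : ℕ} {d : σ →₀ ℕ}
    (hd : s ≤ ∑ i ∈ C, d i) (c : K) :
    monomial d c ∈ Ideal.span (X '' (C : Set σ)) ^ s := by
  classical
  have hprod : ∏ i ∈ C, (X i : MvPolynomial σ K) ^ d i ∈
      Ideal.span (X '' (C : Set σ)) ^ ∑ i ∈ C, d i := by
    rw [← Finset.prod_pow_eq_pow_sum]
    exact Ideal.prod_mem_prod fun i hi =>
      Ideal.pow_mem_pow (Ideal.subset_span (Set.mem_image_of_mem X hi)) _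
  have hdvd : ∏ i ∈ C, (X i : MvPolynomial σ K) ^ d i ∣ monomial d c := by
    rw [monomial_eq, d.prod_of_support_subset (Finset.subset_union_left (s₂ := C)) _ (by simp)]
    exact (Finset.prod_dvd_prod_of_subset _ _ _ Finset.subset_union_right).mul_left _
  exact Ideal.mem_of_dvd _ hdvd (Ideal.pow_le_pow_right hd hprod)

theorem le_sum_of_scaleVars_mem {C : Finset σ} {s : ℕ} {f : MvPolynomial σ K}
    (hf : scaleVars K C f ∈ Ideal.span {Polynomial.X} ^ s) {d : σ →₀ ℕ} (hd : d ∈ f.support) :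
    s ≤ ∑ i ∈ C, d i := by
  rw [Ideal.span_singleton_pow, Ideal.mem_span_singleton] at hf
  by_contra! hlt
  refine mem_support_iff.1 hd ?_
  rw [← coeff_coeff_scaleVars C f d, Polynomial.X_pow_dvd_iff.1 hf _ hlt, coeff_zero]

theorem mem_span_X_image_pow_iff {C : Finset σ} {s : ℕ} {f : MvPolynomial σ K} :
    f ∈ Ideal.span (X '' (C : Set σ)) ^ s ↔ ∀ d ∈ f.support, s ≤ ∑ i ∈ C, d i := by
  refine ⟨fun hf d hd => le_sum_of_scaleVars_mem
    (span_X_image_pow_le_comap_scaleVars C s hf) hd, fun h => ?_⟩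
  rw [f.as_sum]
  exact sum_mem fun d hd => monomial_mem_span_X_image_pow (h d hd) _

theorem span_X_image_pow_eq_comap_scaleVars (C : Finset σ) (s : ℕ) :
    Ideal.span (X '' (C : Set σ)) ^ s =
      (Ideal.span {Polynomial.X} ^ s).comap (scaleVars K C).toRingHom :=
  (span_X_image_pow_le_comap_scaleVars C s).antisymm fun _ hf =>
    mem_span_X_image_pow_iff.2 fun _ => le_sum_of_scaleVars_mem hf

theorem isIntegrallyClosedIdeal_span_X_image_pow [IsReduced K] (C : Finset σ) (s : ℕ) :
    IsIntegrallyClosedIdeal (Ideal.span (X '' (C : Set σ) : Set (MvPolynomial σ K)) ^ s) := by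
  rw [span_X_image_pow_eq_comap_scaleVars]
  exact (isIntegrallyClosedIdeal_span_singleton_pow Polynomial.monic_X.mem_nonZeroDivisors
    isRadical_polynomial_X s).comap _

end VariableIdeals

section IntervalHypergraphs

open MvPolynomial

variable {V : Type*}

/-- The edge ideal of the hypergraph on `V` with edge set `𝓕`, generated by the squarefree
monomials whose supports are the edges. -/
noncomputable def edgeIdeal (K : Type*) [CommRing K] (𝓕 : Set (Finset V)) :
    Ideal (MvPolynomial V K) :=
  Ideal.span ((fun W => ∏ i ∈ W, X i) '' 𝓕)

/-- A transversal, or vertex cover, of the hypergraph with edge set `𝓕`. -/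
def IsTransversal (𝓕 : Set (Finset V)) (C : Finset V) : Prop :=
  ∀ W ∈ 𝓕, ∃ c ∈ C, c ∈ W

/-- The exponent vector of the squarefree monomial with support `W`. -/
noncomputable def squarefreeExponent (W : Finset V) : V →₀ ℕ :=
  ∑ i ∈ W, Finsupp.single i 1

theorem squarefreeExponent_apply [DecidableEq V] (W : Finset V) (i : V) :
    squarefreeExponent W i = if i ∈ W then 1 else 0 := by
  simp [squarefreeExponent, Finsupp.single_apply]

theorem monomial_squarefreeExponent (K : Type*) [CommRing K] (W : Finset V) :
    monomial (squarefreeExponent W) (1 : K) = ∏ i ∈ W, X i :=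
  monomial_sum_one W fun i => Finsupp.single i 1

theorem squarefreeExponent_le_iff {W : Finset V} {a : V →₀ ℕ} :
    squarefreeExponent W ≤ a ↔ W ⊆ a.support := by
  classical
  refine forall_congr' fun i => ?_
  rw [squarefreeExponent_apply, Finsupp.mem_support_iff]
  split_ifs with hi <;> simp [hi, Nat.one_le_iff_ne_zero]

theorem edgeIdeal_le_span_X_image (K : Type*) [CommRing K] {𝓕 : Set (Finset V)} {C : Finset V}
    (hC : IsTransversal 𝓕 C) : edgeIdeal K 𝓕 ≤ Ideal.span (X '' (C : Set V)) := by
  refine Ideal.span_le.2 ?_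
  rintro _ ⟨W, hW, rfl⟩
  obtain ⟨c, hcC, hcW⟩ := hC W hW
  exact Ideal.mem_of_dvd _ (Finset.dvd_prod_of_mem X hcW)
    (Ideal.subset_span (Set.mem_image_of_mem X hcC))

theorem exists_subset_support_of_forall_isTransversal [Finite V] {𝓕 : Set (Finset V)}
    {a : V →₀ ℕ} (ha : ∀ C, IsTransversal 𝓕 C → ∑ i ∈ C, a i ≠ 0) :
    ∃ W ∈ 𝓕, W ⊆ a.support := by
  classical
  have := Fintype.ofFinite V
  by_contra! hne
  refine ha a.supportᶜ (fun W hW => ?_) (Finset.sum_eq_zero fun i hi => by simpa using hi)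
  obtain ⟨i, hiW, hi⟩ := Finset.not_subset.1 (hne W hW)
  exact ⟨i, Finset.mem_compl.2 hi, hiW⟩

variable [LinearOrder V] {𝓕 : Set (Finset V)}

theorem IsTransversal.compl_union_filter_le [Fintype V] (h𝓕 : ∀ W ∈ 𝓕, (W : Set V).OrdConnected)
    {C U : Finset V} (hC : IsTransversal 𝓕 C) {q : V} (hq : q ∈ C)
    (hU : ∀ W ∈ 𝓕, W ⊆ U → ∃ y ∈ W, q ≤ y) : IsTransversal 𝓕 (Uᶜ ∪ {i ∈ C | q ≤ i}) := by
  intro W hW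
  by_cases hWU : W ⊆ U
  · obtain ⟨c, hcC, hcW⟩ := hC W hW
    obtain ⟨y, hyW, hqy⟩ := hU W hW hWU
    rcases le_total q c with hqc | hcq
    · exact ⟨c, by simp [hcC, hqc], hcW⟩
    · exact ⟨q, by simp [hq], (h𝓕 W hW).out hcW hyW ⟨hcq, hqy⟩⟩
  · obtain ⟨i, hiW, hiU⟩ := Finset.not_subset.1 hWU
    exact ⟨i, by simp [hiU], hiW⟩

theorem sum_filter_le_squarefreeExponent {C W : Finset V} {q : V}
    (hq : IsGreatest (C ∩ W : Set V) q) : ∑ i ∈ C with q ≤ i, squarefreeExponent W i = 1 := by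
  obtain ⟨⟨hqC, hqW⟩, hqmax⟩ := hq
  rw [Finset.sum_eq_single_of_mem q (by simpa using hqC), squarefreeExponent_apply,
    if_pos (Finset.mem_coe.1 hqW)]
  intro i hi hiq
  obtain ⟨hiC, hqi⟩ := Finset.mem_filter.1 hi
  rw [squarefreeExponent_apply, if_neg]
  exact fun hiW => hiq ((hqmax ⟨hiC, hiW⟩).antisymm hqi)

-- The edge to remove is one with the smallest right endpoint. A transversal `C` is compared with
-- the part of `C` that starts at its last vertex `q` on this edge, together with the zeros of `a`:
-- this is still a transversal, and `q` is its only vertex whose weight drops.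
theorem exists_eq_add_squarefreeExponent [Finite V] (h𝓕 : ∀ W ∈ 𝓕, (W : Set V).OrdConnected)
    {s : ℕ} {a : V →₀ ℕ} (ha : ∀ C, IsTransversal 𝓕 C → s + 1 ≤ ∑ i ∈ C, a i) :
    ∃ W ∈ 𝓕, ∃ b : V →₀ ℕ, a = b + squarefreeExponent W ∧
      ∀ C, IsTransversal 𝓕 C → s ≤ ∑ i ∈ C, b i := by
  have := Fintype.ofFinite V
  obtain ⟨W, ⟨hW, hWa⟩, hWmin⟩ := Set.exists_min_image {W ∈ 𝓕 | W ⊆ a.support} Finset.max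
    (Set.toFinite _) (exists_subset_support_of_forall_isTransversal fun C hC =>
      Nat.ne_zero_of_lt (ha C hC))
  obtain ⟨b, hb⟩ := exists_add_of_le (squarefreeExponent_le_iff.2 hWa)
  refine ⟨W, hW, b, hb.trans (add_comm _ _), fun C hC => ?_⟩
  obtain ⟨q, hq⟩ : ∃ q, IsGreatest (C ∩ W : Set V) q := by
    rw [← Finset.coe_inter]
    exact ⟨_, Finset.isGreatest_max' _ ((hC W hW).imp fun c hc => Finset.mem_inter.2 hc)⟩
  have hcover : IsTransversal 𝓕 (a.supportᶜ ∪ {i ∈ C | q ≤ i}) := by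
    refine hC.compl_union_filter_le h𝓕 hq.1.1 fun J hJ hJa => ?_
    have hqJ : (q : WithBot V) ≤ J.max := (Finset.le_max hq.1.2).trans (hWmin J ⟨hJ, hJa⟩)
    obtain ⟨y, hy, hqy⟩ := WithBot.coe_le_iff.1 hqJ
    exact ⟨y, Finset.mem_of_max hy, hqy⟩
  refine Nat.le_of_add_le_add_right (b := 1) ?_
  calc s + 1 ≤ ∑ i ∈ a.supportᶜ ∪ {i ∈ C | q ≤ i}, a i := ha _ hcover
    _ = ∑ i ∈ C with q ≤ i, a i :=
        (Finset.sum_subset Finset.subset_union_right fun i hi hiC => by simp_all).symm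
    _ = ∑ i ∈ C with q ≤ i, b i + 1 := by
        simp only [hb, Finsupp.add_apply, Finset.sum_add_distrib,
          sum_filter_le_squarefreeExponent hq, add_comm]
    _ ≤ ∑ i ∈ C, b i + 1 := by
        gcongr
        exact Finset.filter_subset _ _

theorem monomial_mem_edgeIdeal_pow [Finite V] (K : Type*) [CommRing K]
    (h𝓕 : ∀ W ∈ 𝓕, (W : Set V).OrdConnected) {s : ℕ} {a : V →₀ ℕ}
    (ha : ∀ C, IsTransversal 𝓕 C → s ≤ ∑ i ∈ C, a i) (c : K) :
    monomial a c ∈ edgeIdeal K 𝓕 ^ s := by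
  induction s generalizing a with
  | zero => simp
  | succ s ih =>
    obtain ⟨W, hW, b, rfl, hb⟩ := exists_eq_add_squarefreeExponent h𝓕 ha
    have hsplit : monomial (b + squarefreeExponent W) c = monomial b c * ∏ i ∈ W, X i := by
      rw [← monomial_squarefreeExponent, monomial_mul, mul_one]
    rw [hsplit, pow_succ]
    exact Ideal.mul_mem_mul (ih hb) (Ideal.subset_span (Set.mem_image_of_mem _ hW))

theorem edgeIdeal_pow_eq_iInf [Finite V] (K : Type*) [CommRing K]
    (h𝓕 : ∀ W ∈ 𝓕, (W : Set V).OrdConnected) (s : ℕ) :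
    edgeIdeal K 𝓕 ^ s =
      ⨅ (C : Finset V) (_ : IsTransversal 𝓕 C), Ideal.span (X '' (C : Set V)) ^ s := by
  refine le_antisymm (le_iInf₂ fun C hC =>
    Ideal.pow_right_mono (edgeIdeal_le_span_X_image K hC) s) fun f hf => ?_
  rw [f.as_sum]
  refine sum_mem fun d hd => monomial_mem_edgeIdeal_pow K h𝓕 (fun C hC => ?_) _
  exact mem_span_X_image_pow_iff.1 (iInf₂_le (α := Ideal _) C hC hf) d hd

theorem isNormalIdeal_edgeIdeal [Finite V] (K : Type*) [CommRing K] [IsReduced K]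
    (h𝓕 : ∀ W ∈ 𝓕, (W : Set V).OrdConnected) : IsNormalIdeal (edgeIdeal K 𝓕) := by
  intro s _
  rw [edgeIdeal_pow_eq_iInf K h𝓕]
  exact IsIntegrallyClosedIdeal.iInf fun C => IsIntegrallyClosedIdeal.iInf fun _ =>
    isIntegrallyClosedIdeal_span_X_image_pow C s

end IntervalHypergraphs

section PathIdeals

open SimpleGraph

theorem ordConnected_insert_of_covBy {V : Type*} [LinearOrder V] {S : Set V} (hS : S.OrdConnected)
    {a b : V} (hb : b ∈ S) (hab : a ⋖ b ∨ b ⋖ a) : (insert a S).OrdConnected := by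
  rw [Set.ordConnected_def]
  rintro x (rfl | hx) y (rfl | hy) z ⟨hxz, hzy⟩
  · exact Or.inl (hzy.antisymm hxz)
  · rcases hxz.eq_or_lt with rfl | hlt
    · exact Or.inl rfl
    rcases hab with hab | hab
    · exact Or.inr (hS.out hb hy ⟨hab.ge_of_gt hlt, hzy⟩)
    · exact Or.inr (hS.out hb hy ⟨hab.le.trans hxz, hzy⟩)
  · rcases hzy.eq_or_lt with rfl | hlt
    · exact Or.inl rfl
    rcases hab with hab | hab
    · exact Or.inr (hS.out hx hb ⟨hxz, hzy.trans hab.le⟩)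
    · exact Or.inr (hS.out hx hb ⟨hxz, hab.le_of_lt hlt⟩)
  · exact Or.inr (hS.out hx hy ⟨hxz, hzy⟩)

theorem ordConnected_support_of_le_hasse {V : Type*} [LinearOrder V] {G : SimpleGraph V}
    (hG : G ≤ hasse V) {u v : V} (p : G.Walk u v) : {x | x ∈ p.support}.OrdConnected := by
  induction p with
  | nil => simpa using Set.ordConnected_singleton
  | cons hadj p ih =>
    simpa only [Walk.support_cons, List.mem_cons, Set.insert_def, Set.mem_ofPred_eq] using
      ordConnected_insert_of_covBy ih p.start_mem_support (hG hadj)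

theorem pathIdeal_eq_edgeIdeal (K : Type*) [CommRing K] {V : Type*} [DecidableEq V]
    (G : SimpleGraph V) (t : ℕ) :
    pathIdeal K G t = edgeIdeal K {W | ∃ (u v : V) (p : G.Walk u v), p.IsPath ∧
      p.support.length = t ∧ W = p.support.toFinset} := by
  refine congrArg Ideal.span (Set.ext fun m => ⟨?_, ?_⟩)
  · rintro ⟨u, v, p, hp, hlen, rfl⟩
    exact ⟨_, ⟨u, v, p, hp, hlen, rfl⟩, List.prod_toFinset _ hp.support_nodup⟩
  · rintro ⟨_, ⟨u, v, p, hp, hlen, rfl⟩, rfl⟩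
    exact ⟨u, v, p, hp, hlen, List.prod_toFinset _ hp.support_nodup⟩

end PathIdeals

theorem corollary2p4_general (K : Type*) [CommRing K] [IsReduced K] {V : Type*} [LinearOrder V]
    [Finite V] {G : SimpleGraph V} (hG : G ≤ SimpleGraph.hasse V) (t : ℕ) :
    IsNormalIdeal (pathIdeal K G t) := by
  have := Fintype.ofFinite V
  rw [pathIdeal_eq_edgeIdeal]
  refine isNormalIdeal_edgeIdeal K ?_
  rintro _ ⟨u, v, p, -, -, rfl⟩
  rw [List.coe_toFinset]
  exact ordConnected_support_of_le_hasse hG p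

theorem corollary2p4 (K : Type*) [Field K] (n t : ℕ) (ht : 1 ≤ t) (htn : t ≤ n) :
    IsNormalIdeal (pathIdeal K (SimpleGraph.pathGraph n) t) :=
  corollary2p4_general K le_rfl t
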